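/- A valuated group is a group $G$ with a function $\ell:G\to\mathbb Z$ such that, writing $c(x,y)=\frac12\left(\ell(x)+\ell(y)-\ell(xy^{-1})\right)$, one has $\ell(1)=0$, $\ell(x^{-1})=\ell(x)$ and $c(x,y)\ge\min\{c(x,z),c(z,y)\}$ for all $x,y,z\in G$. Let $S=\{x\in G:\ell(x)\le 1\}$, and let $B=\{x\in G:\ell(x)=0\}$, which is a subgroup of $G$. The valuated group $(G,\ell)$ is said to have normal forms if $S$ generates $G$. In that case, a normal form of $g\in G$ is an expression $g=s_1\cdots s_n$ with $n\ge 1$, $s_i\in S$ for all $i$ and $s_is_{i+1}\notin S$ for $1\le i<n$; and $g$ is called cyclically reduced if $g\in S$, or if $g=s_1\cdots s_n$ in normal form with $n\ge 2$ and $\ell(s_ns_1)=2$. Theorem. Let $(G,\ell)$ be a valuated group with normal forms, let $g\in G$ be a cyclically reduced element with $\ell(g)>2$, and let $C_G(g)$ be its centralizer. Then the following are equivalent: (1) $C_G(g)\cap B=1$; (2) $C_G(g)$ is infinite cyclic; (3) $C_G(g)$ is locally cyclic, i.e. every finitely generated subgroup of $C_G(g)$ is cyclic. If these conditions hold and $G$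 has no involutions (elements of order $2$), then $C_G(g)$ is self-normalizing, i.e. $N_G(C_G(g))=C_G(g)$. -/

import Mathlib

/-- The Gromov-product-like quantity `c(x, y) = (ℓ(x) + ℓ(y) - ℓ(x y⁻¹)) / 2`; it may be a
half-integer, so it is taken in `ℚ`. -/
def lyndonC {G : Type*} [Group G] (ℓ : G → ℤ) (x y : G) : ℚ :=
  ((ℓ x : ℚ) + (ℓ y : ℚ) - (ℓ (x * y⁻¹) : ℚ)) / 2

/-- `(G, ℓ)` is a valuated group: `ℓ` is an integer-valued Lyndon length function on `G`. -/
structure IsValuated {G : Type*} [Group G] (ℓ : G → ℤ) : Prop where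
  map_one : ℓ 1 = 0
  map_inv : ∀ x : G, ℓ x⁻¹ = ℓ x
  min_le : ∀ x y z : G, min (lyndonC ℓ x z) (lyndonC ℓ z y) ≤ lyndonC ℓ x y

/-- The set `S` of elements of length at most one. -/
def shortSet {G : Type*} (ℓ : G → ℤ) : Set G := {x | ℓ x ≤ 1}

/-- `(G, ℓ)` is a valuated group with normal forms: a valuated group generated by its elements of
length at most one. -/
structure IsValuatedWithNormalForms {G : Type*} [Group G] (ℓ : G → ℤ) : Prop
    extends IsValuated ℓ where
  closure_shortSet : Subgroup.closure (shortSet ℓ) = ⊤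

theorem IsValuated.lyndonC_nonneg {G : Type*} [Group G] {ℓ : G → ℤ} (h : IsValuated ℓ) (x y : G) :
    0 ≤ lyndonC ℓ x y := by
  have h1 : lyndonC ℓ x 1 = 0 := by simp [lyndonC, h.map_one]
  have h2 : lyndonC ℓ 1 y = 0 := by simp [lyndonC, h.map_one, h.map_inv]
  simpa [h1, h2] using h.min_le x y 1

theorem IsValuated.nonneg {G : Type*} [Group G] {ℓ : G → ℤ} (h : IsValuated ℓ) (x : G) :
    0 ≤ ℓ x := by
  have h1 := h.lyndonC_nonneg x x
  have h2 : lyndonC ℓ x x = (ℓ x : ℚ) := by simp [lyndonC, h.map_one]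
  rw [h2] at h1
  exact_mod_cast h1

theorem IsValuated.map_mul_le {G : Type*} [Group G] {ℓ : G → ℤ} (h : IsValuated ℓ) (x y : G) :
    ℓ (x * y) ≤ ℓ x + ℓ y := by
  have h1 := h.lyndonC_nonneg x y⁻¹
  simp only [lyndonC, h.map_inv, inv_inv] at h1
  have h2 : (ℓ (x * y) : ℚ) ≤ ℓ x + ℓ y := by linarith
  exact_mod_cast h2

/-- The subgroup `B` of elements of length zero. -/
def IsValuated.zeroSubgroup {G : Type*} [Group G] {ℓ : G → ℤ} (h : IsValuated ℓ) : Subgroup G where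
  carrier := {x | ℓ x = 0}
  one_mem' := h.map_one
  mul_mem' := by
    intro a b ha hb
    have h1 := h.map_mul_le a b
    have h2 := h.nonneg (a * b)
    simp only [Set.mem_setOf_eq] at ha hb ⊢
    omega
  inv_mem' := by
    intro a ha
    simpa [h.map_inv] using ha

/-- A sequence of elements of `S` is `S`-reduced if no product of two consecutive terms
is in `S`. -/
def IsShortReduced {G : Type*} [Group G] (ℓ : G → ℤ) (l : List G) : Prop :=
  (∀ s ∈ l, s ∈ shortSet ℓ) ∧ l.IsChain (fun s t => s * t ∉ shortSet ℓ)

/-- `l` is a normal form of `g`: a nonempty `S`-reduced sequence with product `g`. -/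
def IsNormalForm {G : Type*} [Group G] (ℓ : G → ℤ) (g : G) (l : List G) : Prop :=
  l ≠ [] ∧ IsShortReduced ℓ l ∧ l.prod = g

/-- `g` is cyclically reduced: `g ∈ S`, or `g = s₁ ⋯ sₙ` in normal form with `n ≥ 2` and
`ℓ(sₙ s₁) = 2`. -/
def IsCyclicallyReduced {G : Type*} [Group G] (ℓ : G → ℤ) (g : G) : Prop :=
  g ∈ shortSet ℓ ∨
    ∃ (l : List G) (hl : l ≠ []), IsNormalForm ℓ g l ∧ 2 ≤ l.length ∧
      ℓ (l.getLast hl * l.head hl) = 2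

/-- A group is infinite cyclic if it is cyclic and infinite. -/
def IsInfiniteCyclic (H : Type*) [Group H] : Prop := IsCyclic H ∧ Infinite H

/-- A group is locally cyclic if all its finitely generated subgroups are cyclic. -/
def IsLocallyCyclic (H : Type*) [Group H] : Prop :=
  ∀ K : Subgroup H, K.FG → IsCyclic K

/-! Since `g` is cyclically reduced and outside `S`, copies of `g` do not cancel, so ℓ(gᵏ) = kℓ(g)
(`map_pow`): `g` behaves like a hyperbolic tree automorphism. For x in the centralizer C, the
eventual value of ℓ(gᴺx) − Nℓ(g) is a signed translation length along its axis. It is a homomorphism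
C → ℤ (`translation_mul`) with kernel C ∩ B (`translationHom_eq_one_iff`), nonzero at `g`. If C ∩ B
= 1, then C embeds in ℤ and is infinite. Conversely, if b ∈ C ∩ B and ⟨g, b⟩ is cyclic, then b = 1,
because `g` has nonzero translation and b has none. -/

namespace IsValuated

variable {G : Type*} [Group G] {ℓ : G → ℤ}

/-- The isosceles inequality for `c`, in the form in which it forces cancellation to vanish. -/
theorem lyndonC_eq_zero_of_pos (h : IsValuated ℓ) {x y z : G} (hxy : lyndonC ℓ x y = 0)
    (hzy : 0 < lyndonC ℓ z y) : lyndonC ℓ x z = 0 := by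
  have h1 := h.min_le x y z
  have h2 := h.lyndonC_nonneg x z
  rw [hxy] at h1
  rcases min_le_iff.1 h1 with h3 | h3
  · exact le_antisymm h3 h2
  · exact absurd hzy (not_lt.2 h3)

theorem lyndonC_comm (h : IsValuated ℓ) (x y : G) : lyndonC ℓ x y = lyndonC ℓ y x := by
  have h1 : ℓ (x * y⁻¹) = ℓ (y * x⁻¹) := by
    rw [← h.map_inv]
    simp
  simp only [lyndonC, h1]
  ring

theorem lyndonC_le_right (h : IsValuated ℓ) (x y : G) : lyndonC ℓ x y ≤ ℓ y := by
  have h1 := h.map_mul_le (x * y⁻¹) y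
  rw [inv_mul_cancel_right] at h1
  have h2 : (ℓ x : ℚ) ≤ ℓ (x * y⁻¹) + ℓ y := by exact_mod_cast h1
  simp only [lyndonC]
  linarith

/-- A product of elements of length one without cancellation between neighbours has length the
number of factors. -/
theorem map_list_prod (h : IsValuated ℓ) : ∀ l : List G, (∀ s ∈ l, ℓ s = 1) →
    l.IsChain (fun s t => ℓ (s * t) = 2) → ℓ l.prod = l.length
  | [], _, _ => by simp [h.map_one]
  | [a], h1, _ => by simp [h1 a (by simp)]
  | a :: b :: l, h1, h2 => by
    rw [List.isChain_cons_cons] at h2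
    have ih := h.map_list_prod (b :: l) (fun s hs => h1 s (by simp [hs])) h2.2
    have ih' := h.map_list_prod l (fun s hs => h1 s (by simp [hs])) h2.2.tail
    have ha := h1 a (by simp)
    have hb := h1 b (by simp)
    rw [List.prod_cons, List.length_cons] at ih
    have hab : lyndonC ℓ a b⁻¹ = 0 := by
      simp only [lyndonC, inv_inv, h.map_inv, h2.1, ha, hb]
      norm_num
    -- The value is 1: the two inverses share the final factor b⁻¹, so `a` cancels against the whole
    -- product no more than against `b`.
    have hpos : 0 < lyndonC ℓ (b * l.prod)⁻¹ b⁻¹ := by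
      have h3 : ℓ ((b * l.prod)⁻¹ * b⁻¹⁻¹) = l.length := by
        rw [← h.map_inv, ← ih']
        simp
      simp only [lyndonC, h3, h.map_inv, hb, ih]
      push_cast
      linarith
    have h4 := h.lyndonC_eq_zero_of_pos hab hpos
    simp only [lyndonC, inv_inv, h.map_inv, ih, ha] at h4
    have h5 : (ℓ (a * (b * l.prod)) : ℚ) = ((l.length + 1 + 1 : ℤ) : ℚ) := by
      push_cast at h4 ⊢
      linarith
    simp only [List.prod_cons, List.length_cons]
    exact_mod_cast h5

/-- In an `S`-reduced sequence with at least two terms, neighbours do not cancel. -/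
theorem map_eq_one_of_isShortReduced (h : IsValuated ℓ) : ∀ l : List G, 2 ≤ l.length →
    IsShortReduced ℓ l → (∀ s ∈ l, ℓ s = 1) ∧ l.IsChain (fun s t => ℓ (s * t) = 2) := by
  have key : ∀ s t : G, ℓ s ≤ 1 → ℓ t ≤ 1 → s * t ∉ shortSet ℓ →
      ℓ s = 1 ∧ ℓ t = 1 ∧ ℓ (s * t) = 2 := by
    intro s t hs ht hst
    have h1 := h.map_mul_le s t
    simp only [shortSet, Set.mem_ofPred_eq, not_le] at hst
    omega
  intro l
  induction l with
  | nil => simp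
  | cons a l ih =>
    intro hl ⟨h1, h2⟩
    cases l with
    | nil => simp at hl
    | cons b l =>
      rw [List.isChain_cons_cons] at h2
      obtain ⟨ha, hb, hab⟩ := key a b (h1 a (by simp)) (h1 b (by simp)) h2.1
      cases l with
      | nil => simp [ha, hb, hab]
      | cons d l =>
        obtain ⟨h3, h4⟩ := ih (by simp) ⟨fun s hs => h1 s (List.mem_cons_of_mem _ hs), h2.2⟩
        refine ⟨?_, List.isChain_cons_cons.2 ⟨hab, h4⟩⟩
        intro s hs
        rcases List.mem_cons.1 hs with rfl | hs
        · exact ha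
        · exact h3 s hs

/-- A cyclically reduced element outside `S` does not cancel against itself. -/
theorem map_mul_self_of_isCyclicallyReduced (h : IsValuated ℓ) {g : G}
    (hg : IsCyclicallyReduced ℓ g) (hS : g ∉ shortSet ℓ) : ℓ (g * g) = 2 * ℓ g := by
  rcases hg with hg | ⟨l, hl, ⟨-, hred, rfl⟩, hlen, hcyc⟩
  · exact absurd hg hS
  · obtain ⟨h1, h2⟩ := h.map_eq_one_of_isShortReduced l hlen hred
    rw [h.map_list_prod l h1 h2, ← List.prod_append, h.map_list_prod (l ++ l)]
    · simp only [List.length_append]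
      push_cast
      ring
    · intro s hs
      rcases List.mem_append.1 hs with hs | hs <;> exact h1 s hs
    · refine List.isChain_append.2 ⟨h2, h2, ?_⟩
      intro x hx y hy
      rw [List.getLast?_eq_some_getLast hl, Option.mem_some_iff] at hx
      rw [List.head?_eq_some_head hl, Option.mem_some_iff] at hy
      rw [← hx, ← hy, hcyc]

theorem map_pow (h : IsValuated ℓ) {g : G} (hg : ℓ (g * g) = 2 * ℓ g) (hpos : 0 < ℓ g)
    (k : ℕ) : ℓ (g ^ k) = k * ℓ g := by
  -- Two consecutive powers are carried along because c(gᵏ⁺¹, g) = ℓ(g) needs both lengths.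
  have key : ∀ k : ℕ, ℓ (g ^ k) = k * ℓ g ∧ ℓ (g ^ (k + 1)) = (k + 1 : ℕ) * ℓ g := by
    intro k
    induction k with
    | zero => simp [h.map_one]
    | succ k ih =>
      refine ⟨ih.2, ?_⟩
      have hpos' : (0 : ℚ) < ℓ g := by exact_mod_cast hpos
      have h0 : lyndonC ℓ g⁻¹ g = 0 := by
        have : ℓ (g⁻¹ * g⁻¹) = 2 * ℓ g := by
          rw [← hg, ← h.map_inv (g * g), mul_inv_rev]
        simp only [lyndonC, h.map_inv, this]
        push_cast
        ring
      have h1 : 0 < lyndonC ℓ (g ^ (k + 1)) g := by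
        have : ℓ (g ^ (k + 1) * g⁻¹) = k * ℓ g := by
          rw [pow_succ, mul_inv_cancel_right, ih.1]
        simp only [lyndonC, this, ih.2]
        push_cast
        linarith
      have h2 := h.lyndonC_eq_zero_of_pos h0 h1
      have h3 : ℓ (g⁻¹ * (g ^ (k + 1))⁻¹) = ℓ (g ^ (k + 1 + 1)) := by
        rw [← h.map_inv (g ^ (k + 1 + 1)), pow_succ g (k + 1), mul_inv_rev]
      simp only [lyndonC, h.map_inv, h3, ih.2] at h2
      have h4 : (ℓ (g ^ (k + 1 + 1)) : ℚ) = (((k + 1 + 1 : ℕ) * ℓ g : ℤ) : ℚ) := by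
        push_cast at h2 ⊢
        linarith
      exact_mod_cast h4
  exact (key k).1

/-- The integers ℓ(gᴺx) − Nℓ(g) decrease in N and are at least −ℓ(x), so they become constant once
the minimum is reached. -/
theorem exists_eventually_map_pow_mul (h : IsValuated ℓ) {g : G}
    (hpow : ∀ k : ℕ, ℓ (g ^ k) = k * ℓ g) (x : G) :
    ∃ t : ℤ, ∀ᶠ N : ℕ in Filter.atTop, ℓ (g ^ N * x) = N * ℓ g + t := by
  have hbound : ∀ N : ℕ, 0 ≤ ℓ (g ^ N * x) - N * ℓ g + ℓ x := by
    intro N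
    have h1 := h.map_mul_le (g ^ N * x) x⁻¹
    rw [mul_inv_cancel_right, h.map_inv, hpow] at h1
    linarith
  have hanti : Antitone fun N : ℕ => ℓ (g ^ N * x) - N * ℓ g := by
    refine antitone_nat_of_succ_le fun N => ?_
    have h1 := h.map_mul_le g (g ^ N * x)
    rw [← mul_assoc, ← pow_succ'] at h1
    push_cast
    linarith
  let f : ℕ → ℕ := fun N => (ℓ (g ^ N * x) - N * ℓ g + ℓ x).toNat
  let M := Function.argmin f
  refine ⟨ℓ (g ^ M * x) - M * ℓ g, Filter.eventually_atTop.2 ⟨M, fun N hN => ?_⟩⟩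
  have h1 : f M ≤ f N := Function.argmin_le f N
  have h2 := hanti hN
  have h3 := hbound M
  have h4 := hbound N
  simp only [f] at h1 h2
  omega

/-- The signed displacement, along the axis of `g`, of an element that commutes with `g`. -/
noncomputable def translation (h : IsValuated ℓ) {g : G}
    (hpow : ∀ k : ℕ, ℓ (g ^ k) = k * ℓ g) (x : G) : ℤ :=
  (h.exists_eventually_map_pow_mul hpow x).choose

theorem eventually_map_pow_mul (h : IsValuated ℓ) {g : G}
    (hpow : ∀ k : ℕ, ℓ (g ^ k) = k * ℓ g) (x : G) :
    ∀ᶠ N : ℕ in Filter.atTop, ℓ (g ^ N * x) = N * ℓ g + h.translation hpow x :=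
  (h.exists_eventually_map_pow_mul hpow x).choose_spec

theorem translation_self (h : IsValuated ℓ) {g : G} (hpow : ∀ k : ℕ, ℓ (g ^ k) = k * ℓ g) :
    h.translation hpow g = ℓ g := by
  obtain ⟨N, hN⟩ := (h.eventually_map_pow_mul hpow g).exists
  rw [← pow_succ, hpow] at hN
  push_cast at hN
  linarith

theorem translation_eq_zero_of_map_eq_zero (h : IsValuated ℓ) {g : G}
    (hpow : ∀ k : ℕ, ℓ (g ^ k) = k * ℓ g) {x : G} (hx : ℓ x = 0) :
    h.translation hpow x = 0 := by
  obtain ⟨N, hN⟩ := (h.eventually_map_pow_mul hpow x).exists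
  have h1 := h.map_mul_le (g ^ N) x
  have h2 := h.map_mul_le (g ^ N * x) x⁻¹
  rw [mul_inv_cancel_right, h.map_inv] at h2
  rw [hpow] at h1 h2
  linarith

/-- Commutation gives ℓ(gᴺxg⁻ᴺ) = ℓ(x), so for large N the elements gᴺx and gᴺ overlap in more than
ℓ(y) and have the same c with y⁻¹. Expanding that equality gives additivity. -/
theorem translation_mul (h : IsValuated ℓ) {g : G} (hpow : ∀ k : ℕ, ℓ (g ^ k) = k * ℓ g)
    (hpos : 0 < ℓ g) {x : G} (hx : Commute g x) (y : G) :
    h.translation hpow (x * y) = h.translation hpow x + h.translation hpow y := by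
  obtain ⟨N, ⟨⟨hNx, hNy⟩, hNxy⟩, hN⟩ := (((h.eventually_map_pow_mul hpow x).and
    (h.eventually_map_pow_mul hpow y)).and (h.eventually_map_pow_mul hpow (x * y))).and
    (Filter.eventually_gt_atTop (ℓ x + ℓ y).toNat) |>.exists
  have hNlt : (ℓ x : ℚ) + ℓ y < N * ℓ g := by
    have h1 : ℓ x + ℓ y < N := by omega
    have h2 : (N : ℤ) ≤ N * ℓ g := le_mul_of_one_le_right (by omega) (by omega)
    exact_mod_cast h1.trans_le h2
  have hfar : (ℓ y : ℚ) < lyndonC ℓ (g ^ N * x) (g ^ N) := by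
    have h1 : ℓ (g ^ N * x * (g ^ N)⁻¹) = ℓ x := by
      rw [(hx.pow_left N).eq, mul_inv_cancel_right]
    have h2 := h.map_mul_le (g ^ N * x) x⁻¹
    rw [mul_inv_cancel_right, h.map_inv, hpow] at h2
    have h3 : (N * ℓ g : ℚ) ≤ ℓ (g ^ N * x) + ℓ x := by exact_mod_cast h2
    simp only [lyndonC, h1, hpow]
    push_cast
    linarith
  have h1 := h.lyndonC_le_right (g ^ N) y⁻¹
  have h2 := h.lyndonC_le_right (g ^ N * x) y⁻¹
  rw [h.map_inv] at h1 h2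
  have heq : lyndonC ℓ (g ^ N * x) y⁻¹ = lyndonC ℓ (g ^ N) y⁻¹ := by
    apply le_antisymm
    · have h3 := h.min_le (g ^ N) y⁻¹ (g ^ N * x)
      rw [h.lyndonC_comm (g ^ N) (g ^ N * x)] at h3
      rcases min_le_iff.1 h3 with h4 | h4
      · linarith
      · exact h4
    · rcases min_le_iff.1 (h.min_le (g ^ N * x) y⁻¹ (g ^ N)) with h4 | h4
      · linarith
      · exact h4
  simp only [lyndonC, inv_inv, mul_assoc, hNx, hNy, hNxy, hpow] at heq
  have h5 : (h.translation hpow (x * y) : ℚ) =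
      ((h.translation hpow x + h.translation hpow y : ℤ) : ℚ) := by
    push_cast at heq ⊢
    linarith
  exact_mod_cast h5

/-- The translation homomorphism on the centralizer of `g`. -/
noncomputable def translationHom (h : IsValuated ℓ) {g : G}
    (hpow : ∀ k : ℕ, ℓ (g ^ k) = k * ℓ g) (hpos : 0 < ℓ g) :
    Subgroup.centralizer {g} →* Multiplicative ℤ :=
  MonoidHom.mk' (fun x => Multiplicative.ofAdd (h.translation hpow x)) fun x y => by
    rw [← ofAdd_add, Subgroup.coe_mul, h.translation_mul hpow hpos
      (Subgroup.mem_centralizer_singleton_iff.1 x.2).symm]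

theorem translationHom_eq_one_iff (h : IsValuated ℓ) {g : G}
    (hpow : ∀ k : ℕ, ℓ (g ^ k) = k * ℓ g) (hpos : 0 < ℓ g) (x : Subgroup.centralizer {g}) :
    h.translationHom hpow hpos x = 1 ↔ ℓ x = 0 := by
  have hdef (y : Subgroup.centralizer {g}) : h.translationHom hpow hpos y = 1 ↔
      h.translation hpow y = 0 := by
    simp [translationHom]
  refine ⟨fun hx => ?_, fun hx => (hdef x).2 (h.translation_eq_zero_of_map_eq_zero hpow hx)⟩
  -- With x⁻¹ also of translation zero, comparing gᴺ and g⁻ᴺ through x yields 0 ≥ ℓ(x)/2.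
  have hx' : h.translationHom hpow hpos x⁻¹ = 1 := by rw [_root_.map_inv, hx, inv_one]
  rw [hdef] at hx hx'
  have hcomm : Commute g (x : G) := (Subgroup.mem_centralizer_singleton_iff.1 x.2).symm
  obtain ⟨N, hN, hN'⟩ := ((h.eventually_map_pow_mul hpow x).and
    (h.eventually_map_pow_mul hpow (x⁻¹ : Subgroup.centralizer {g}))).exists
  rw [hx, add_zero] at hN
  rw [hx', add_zero, Subgroup.coe_inv] at hN'
  have h1 : lyndonC ℓ (g ^ N) (g ^ N)⁻¹ = 0 := by
    simp only [lyndonC, inv_inv, h.map_inv, ← pow_add, hpow]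
    push_cast
    ring
  have h2 : lyndonC ℓ (g ^ N) (x : G) = ℓ x / 2 := by
    simp only [lyndonC, hpow, hN']
    ring
  have h3 : lyndonC ℓ (x : G) (g ^ N)⁻¹ = ℓ x / 2 := by
    simp only [lyndonC, inv_inv, h.map_inv, ← (hcomm.pow_left N).eq, hpow, hN]
    ring
  have h4 := h.min_le (g ^ N) (g ^ N)⁻¹ x
  rw [h1, h2, h3, min_self] at h4
  have h5 : (ℓ x : ℚ) ≤ 0 := by linarith
  exact le_antisymm (by exact_mod_cast h5) (h.nonneg _)

end IsValuated

/-- If the centralizer of `g` is infinite cyclic then an element normalizing it either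
centralizes `g` or is an involution. -/
theorem Subgroup.normalizer_centralizer_singleton_eq {G : Type*} [Group G] {g : G}
    (hcyc : IsInfiniteCyclic (Subgroup.centralizer {g})) (hinv : ∀ x : G, orderOf x ≠ 2) :
    Subgroup.normalizer (Subgroup.centralizer {g} : Set G) = Subgroup.centralizer {g} := by
  obtain ⟨hc, hinf⟩ := hcyc
  refine le_antisymm (fun x hx => ?_) Subgroup.le_normalizer
  obtain ⟨⟨h, hh⟩, hgen⟩ := hc.exists_generator
  have hgen' : ∀ y ∈ Subgroup.centralizer {g}, ∃ k : ℤ, h ^ k = y := fun y hy => by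
    obtain ⟨k, hk⟩ := Subgroup.mem_zpowers_iff.1 (hgen ⟨y, hy⟩)
    exact ⟨k, by simpa using congrArg Subtype.val hk⟩
  have hord : ∀ k : ℤ, h ^ k = 1 → k = 0 := by
    intro k hk
    have h0 : orderOf (⟨h, hh⟩ : Subgroup.centralizer {g}) = 0 :=
      Infinite.orderOf_eq_zero_of_forall_mem_zpowers hgen
    rw [← Subgroup.orderOf_coe] at h0
    have h1 := orderOf_dvd_iff_zpow_eq_one.2 hk
    rw [show orderOf h = 0 from h0] at h1
    simpa using h1
  rw [Subgroup.mem_normalizer_iff] at hx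
  obtain ⟨a, ha⟩ := hgen' _ ((hx h).1 hh)
  obtain ⟨b, hb⟩ : ∃ b : ℤ, h ^ b = x⁻¹ * h * x := by
    refine hgen' _ ((hx _).2 ?_)
    simpa [mul_assoc] using hh
  have hab : a * b = 1 := by
    have h1 : h ^ (a * b) = h := by
      rw [zpow_mul, ha, conj_zpow, hb]
      group
    have h2 : h ^ (a * b - 1) = 1 := by rw [zpow_sub, h1, zpow_one, mul_inv_cancel]
    linarith [hord _ h2]
  have hg : g ∈ Subgroup.centralizer {g} := Subgroup.mem_centralizer_singleton_iff.2 rfl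
  obtain ⟨m, hm⟩ := hgen' g hg
  rcases Int.eq_one_or_neg_one_of_mul_eq_one hab with rfl | rfl
  · rw [zpow_one] at ha
    have hxh : Commute x h := (eq_mul_inv_iff_mul_eq.1 ha).symm
    rw [Subgroup.mem_centralizer_singleton_iff, ← hm]
    exact (hxh.zpow_right m).eq
  · exfalso
    have hconj : ∀ k : ℤ, x * h ^ k * x⁻¹ = h ^ (-k) := fun k => by
      rw [← conj_zpow, ← ha, ← zpow_mul, neg_one_mul]
    have hsq : x * x ∈ Subgroup.centralizer {g} := by
      rw [Subgroup.mem_centralizer_singleton_iff, ← hm]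
      have h1 : x * (x * h ^ m * x⁻¹) * x⁻¹ = h ^ m := by rw [hconj, hconj, neg_neg]
      calc x * x * h ^ m = x * (x * h ^ m * x⁻¹) * x⁻¹ * (x * x) := by group
        _ = h ^ m * (x * x) := by rw [h1]
    obtain ⟨k, hk⟩ := hgen' _ hsq
    have h1 := hconj k
    -- Conjugation by x inverts hᵏ = x², yet x commutes with its own square.
    have h2 : h ^ k = h ^ (-k) := by
      rw [← h1, hk]
      group
    have h3 : h ^ (k + k) = 1 := by
      rw [zpow_add]
      nth_rewrite 1 [h2]
      rw [zpow_neg, inv_mul_cancel]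
    have hk0 : k = 0 := by linarith [hord _ h3]
    rw [hk0, zpow_zero] at hk
    refine hinv x (orderOf_eq_prime (by rw [pow_two, ← hk]) ?_)
    -- If x = 1, inversion would fix h, so h² = 1 against infinite order.
    rintro rfl
    have h4 := hord 2 (by
      have h5 : h ^ (-1 : ℤ) = h := by simpa using ha
      rw [zpow_two]
      nth_rewrite 1 [← h5]
      simp)
    exact absurd h4 two_ne_zero

theorem theorem7p5 {G : Type*} [Group G] (ℓ : G → ℤ) (hG : IsValuatedWithNormalForms ℓ)
    (g : G) (hg : IsCyclicallyReduced ℓ g) (hlen : 2 < ℓ g) :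
    List.TFAE [Subgroup.centralizer {g} ⊓ hG.toIsValuated.zeroSubgroup = ⊥,
      IsInfiniteCyclic (Subgroup.centralizer {g}),
      IsLocallyCyclic (Subgroup.centralizer {g})] ∧
    (Subgroup.centralizer {g} ⊓ hG.toIsValuated.zeroSubgroup = ⊥ →
      (∀ x : G, orderOf x ≠ 2) →
      Subgroup.normalizer (Subgroup.centralizer {g} : Set G) = Subgroup.centralizer {g}) := by
  have h := hG.toIsValuated
  have hpos : 0 < ℓ g := by omega
  have hpow : ∀ k : ℕ, ℓ (g ^ k) = k * ℓ g :=
    h.map_pow (h.map_mul_self_of_isCyclicallyReduced hg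
      (by simp only [shortSet, Set.mem_ofPred_eq]; omega)) hpos
  let γ : Subgroup.centralizer {g} := ⟨g, Subgroup.mem_centralizer_singleton_iff.2 rfl⟩
  have hγ : ∀ k : ℤ, h.translationHom hpow hpos (γ ^ k) = 1 → k = 0 := by
    intro k hk
    rw [map_zpow] at hk
    have h1 : k * ℓ g = 0 := by
      have := congrArg Multiplicative.toAdd hk
      simpa [IsValuated.translationHom, γ, h.translation_self hpow] using this
    exact (mul_eq_zero.1 h1).resolve_right hpos.ne'
  have h12 : Subgroup.centralizer {g} ⊓ hG.toIsValuated.zeroSubgroup = ⊥ →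
      IsInfiniteCyclic (Subgroup.centralizer {g}) := by
    intro h1
    have hinj : Function.Injective (h.translationHom hpow hpos) := by
      refine (injective_iff_map_eq_one _).2 fun x hx => ?_
      rw [h.translationHom_eq_one_iff] at hx
      have hmem : (x : G) ∈ Subgroup.centralizer {g} ⊓ hG.toIsValuated.zeroSubgroup := ⟨x.2, hx⟩
      rw [h1, Subgroup.mem_bot] at hmem
      exact Subtype.ext hmem
    refine ⟨isCyclic_of_injective _ hinj, Infinite.of_injective (fun k : ℤ => γ ^ k) ?_⟩
    intro a b hab
    have h2 : γ ^ (a - b) = 1 := by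
      rw [zpow_sub, show γ ^ a = γ ^ b from hab, mul_inv_cancel]
    linarith [hγ (a - b) (by rw [h2, map_one])]
  refine ⟨?_, fun h1 hinv => Subgroup.normalizer_centralizer_singleton_eq (h12 h1) hinv⟩
  tfae_have 1 → 2 := h12
  tfae_have 2 → 3 := fun h2 K _ => by
    have := h2.1
    infer_instance
  tfae_have 3 → 1 := by
    intro h3
    refine (Subgroup.eq_bot_iff_forall _).2 fun b hb => ?_
    let β : Subgroup.centralizer {g} := ⟨b, hb.1⟩
    have hβ : h.translationHom hpow hpos β = 1 :=
      (h.translationHom_eq_one_iff hpow hpos β).2 hb.2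
    obtain ⟨u, hu⟩ := (Subgroup.isCyclic_iff_exists_zpowers_eq_top _).1
      (h3 (Subgroup.closure {γ, β}) ((Subgroup.fg_iff _).2 ⟨{γ, β}, rfl, Set.toFinite _⟩))
    have hγu : γ ∈ Subgroup.zpowers u := hu ▸ Subgroup.subset_closure (by simp)
    have hβu : β ∈ Subgroup.zpowers u := hu ▸ Subgroup.subset_closure (by simp)
    obtain ⟨m, hm⟩ := Subgroup.mem_zpowers_iff.1 hγu
    obtain ⟨k, hk⟩ := Subgroup.mem_zpowers_iff.1 hβu
    -- γᵏ = uᵐᵏ = βᵐ has zero translation.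
    have hk0 : k = 0 := by
      apply hγ
      rw [← hm, ← zpow_mul, mul_comm, zpow_mul, hk, map_zpow, hβ, one_zpow]
    have hβ1 : β = 1 := by rw [← hk, hk0, zpow_zero]
    exact congrArg Subtype.val hβ1
  tfae_finish
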